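/- Let $\ell$ be odd with $3\mid\ell$, let $\varepsilon\in\mathbb C$ be a primitive $\ell$-th root of $1$, and let $\Lambda$ be the weight lattice of $\mathfrak{sl}_3(\mathbb C)$ with simple roots $\alpha=\alpha_1,\beta=\alpha_2$, fundamental weights $\lambda_1,\lambda_2$ and $(\lambda_i|\alpha_j)=\delta_{ij}$. Let $U_\varepsilon^\Lambda=U_\varepsilon^\Lambda(\mathfrak{sl}_3)$ be the De Concini–Kac quantized enveloping algebra, i.e. the $\mathbb C$-algebra with generators $E_{\alpha_i},F_{\alpha_i}$ ($i=1,2$) and $K_\mu$ ($\mu\in\Lambda$) and relations $$K_0=1,\quad K_\mu K_\nu=K_{\mu+\nu},\quad K_\mu E_{\alpha_i}=\varepsilon^{(\mu|\alpha_i)}E_{\alpha_i}K_\mu,\quad K_\mu F_{\alpha_i}=\varepsilon^{-(\mu|\alpha_i)}F_{\alpha_i}K_\mu,$$ $$E_{\alpha_i}F_{\alpha_j}-F_{\alpha_j}E_{\alpha_i}=\delta_{ij}\frac{K_{\alpha_i}-K_{-\alpha_i}}{\varepsilon-\varepsilon^{-1}},$$ together with the quantum Serre relations $X_i^2X_j-(\varepsilon+\varepsilon^{-1})X_iX_jX_i+X_jX_i^2=0$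 for $i\ne j$ and $X=E,F$ (where $X_i=X_{\alpha_i}$). Put $E_{\alpha+\beta}=-E_\beta E_\alpha+\varepsilon^{-1}E_\alpha E_\beta$ and $F_{\alpha+\beta}=-F_\alpha F_\beta+\varepsilon F_\beta F_\alpha$. Let $Z_0^\Lambda$ be the $\ell$-center, the subalgebra generated by $E_\gamma^\ell,F_\gamma^\ell$ ($\gamma\in\{\alpha,\beta,\alpha+\beta\}$) and $K_\mu^\ell$ ($\mu\in\Lambda$). An $\ell$-character is an algebra homomorphism $\eta:Z_0^\Lambda\to\mathbb C$; a module has $\ell$-character $\eta$ if $Z_0^\Lambda$ acts on it through $\eta$, and $U_\eta^\Lambda=U_\varepsilon^\Lambda/(\ker\eta)U_\varepsilon^\Lambda$. Let $\pi_\Lambda(\eta)=(t^{-1}u)^{-1}(tv)\in SL_3(\mathbb C)$, where $t$ is the diagonal matrix of determinant $1$ with $\mu(t)=\eta(K_\mu^\ell)$ for all $\mu\in\Lambda$, $v$ is the product over $\gamma=\alpha,\alpha+\beta,\beta$ (in this order) of $\exp(x_\gamma e_\gamma)$ with $x_\gamma=(\varepsilon-\varepsilon^{-1})^\ell\eta(E_\gamma^\ell)$,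 and $u$ is the product over $\gamma=\beta,\alpha+\beta,\alpha$ (in this order) of $\exp(y_\gamma f_\gamma)$ with $y_\gamma=(\varepsilon^{-1}-\varepsilon)^\ell\eta(F_\gamma^\ell)$; here $e_\alpha=e_{12}$, $e_\beta=e_{23}$, $e_{\alpha+\beta}=e_{13}$ are matrix units and $f_\gamma=e_\gamma^{T}$. Call $\eta$ central if $\pi_\Lambda(\eta)\in Z(SL_3(\mathbb C))$, and call a $U_\eta^\Lambda$-module small if its dimension is $\ell^{\frac12\dim\mathcal O}$, where $\mathcal O$ is the conjugacy class of $\pi_\Lambda(\eta)$ in $SL_3(\mathbb C)$. (1) If $\eta$ is central and $\pi_\Lambda(\eta)$ has order $3$, then $U_\eta^\Lambda$ has no small module, and it has no $1$-dimensional module. (2) Every irreducible $U_\varepsilon^\Lambda$-module with a central $\ell$-character $\eta$ such that $\pi_\Lambda(\eta)\ne1$ has dimension at least $3$. (3) Let $\ell=3$ and let $z\in\mathbb C$ satisfy $z^3=\varepsilon^2$. Then there is a central $\ell$-character $\eta$ with $\pi_\Lambda(\eta)\neq1$ and $\eta(K_{\lambda_1}^6)=\varepsilon$, and an irreducible $U_\eta^\Lambda$-module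 structure on $V=\mathbb C^3$ given by $E_\alpha\mapsto e_{23}$, $E_\beta\mapsto e_{31}$, $F_\alpha\mapsto e_{32}$, $F_\beta\mapsto e_{13}$, $K_{\lambda_1}\mapsto\operatorname{diag}(z,z^{-2},z)$, $K_\alpha\mapsto\operatorname{diag}(1,\varepsilon,\varepsilon^2)$; so the bound in (2) is attained. Moreover the dual module $V^*$, with $(E_{\alpha_i}f)(v)=-f(K_{-\alpha_i}E_{\alpha_i}v)$, $(F_{\alpha_i}f)(v)=-f(F_{\alpha_i}K_{\alpha_i}v)$ and $(K_\mu f)(v)=f(K_{-\mu}v)$, is an irreducible $U_{\eta^*}^\Lambda$-module for some central $\ell$-character $\eta^*$ with $\pi_\Lambda(\eta^*)\ne1$ and $\eta^*(K_{\lambda_1}^6)=\varepsilon^2$. -/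

import Mathlib

noncomputable section

namespace QuantumSL3

/-- The weight lattice `Λ` of `sl₃`, in coordinates with respect to the fundamental weights
`λ₁ = ![1, 0]` and `λ₂ = ![0, 1]`. -/
abbrev Weight : Type := Fin 2 → ℤ

/-- The simple roots `α₁ = 2λ₁ - λ₂` and `α₂ = -λ₁ + 2λ₂`.  Index `0` is called `α` and
index `1` is called `β` below. -/
def simpleRoot (i : Fin 2) : Weight := if i = 0 then ![2, -1] else ![-1, 2]

/-- The pairing `(μ | α_j)`, normalized by `(α | α) = 2`: since `(λ_i | α_j) = δ_ij`, it is the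
`j`-th coordinate of `μ`. -/
def pairing (μ : Weight) (j : Fin 2) : ℤ := μ j

/-- Names of the generators `E_α`, `F_α` (`α` simple) and `K_μ` (`μ ∈ Λ`). -/
inductive Gen : Type
  | E (i : Fin 2)
  | F (i : Fin 2)
  | K (μ : Weight)

/-- The generators inside the free algebra. -/
abbrev gE (i : Fin 2) : FreeAlgebra ℂ Gen := FreeAlgebra.ι ℂ (Gen.E i)

/-- The generators inside the free algebra. -/
abbrev gF (i : Fin 2) : FreeAlgebra ℂ Gen := FreeAlgebra.ι ℂ (Gen.F i)

/-- The generators inside the free algebra. -/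
abbrev gK (μ : Weight) : FreeAlgebra ℂ Gen := FreeAlgebra.ι ℂ (Gen.K μ)

/-- The defining relations of the De Concini-Kac quantized enveloping algebra of `sl₃` with weight
lattice `Λ`, at the parameter `ε` (all roots have `(α|α)/2 = 1`, so `ε_α = ε`, and the quantum
integer `[2]_ε` is `ε + ε⁻¹`). -/
inductive Rel (ε : ℂ) : FreeAlgebra ℂ Gen → FreeAlgebra ℂ Gen → Prop
  | K_zero : Rel ε (gK 0) 1
  | K_add (μ ν : Weight) : Rel ε (gK μ * gK ν) (gK (μ + ν))
  | K_E (μ : Weight) (i : Fin 2) :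
      Rel ε (gK μ * gE i) ((ε ^ pairing μ i) • (gE i * gK μ))
  | K_F (μ : Weight) (i : Fin 2) :
      Rel ε (gK μ * gF i) ((ε ^ (-pairing μ i)) • (gF i * gK μ))
  | E_F_same (i : Fin 2) :
      Rel ε (gE i * gF i - gF i * gE i)
        ((ε - ε⁻¹)⁻¹ • (gK (simpleRoot i) - gK (-simpleRoot i)))
  | E_F_diff (i j : Fin 2) (h : i ≠ j) : Rel ε (gE i * gF j - gF j * gE i) 0
  | serre_E (i j : Fin 2) (h : i ≠ j) :
      Rel ε (gE i ^ 2 * gE j - (ε + ε⁻¹) • (gE i * gE j * gE i) + gE j * gE i ^ 2) 0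
  | serre_F (i j : Fin 2) (h : i ≠ j) :
      Rel ε (gF i ^ 2 * gF j - (ε + ε⁻¹) • (gF i * gF j * gF i) + gF j * gF i ^ 2) 0

/-- The algebra `U_ε^Λ(sl₃)`. -/
abbrev U (ε : ℂ) : Type := RingQuot (Rel ε)

/-- The element `E_{α_i}` of `U_ε^Λ(sl₃)`. -/
def E (ε : ℂ) (i : Fin 2) : U ε := RingQuot.mkAlgHom ℂ (Rel ε) (gE i)

/-- The element `F_{α_i}` of `U_ε^Λ(sl₃)`. -/
def F (ε : ℂ) (i : Fin 2) : U ε := RingQuot.mkAlgHom ℂ (Rel ε) (gF i)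

/-- The element `K_μ` of `U_ε^Λ(sl₃)`. -/
def K (ε : ℂ) (μ : Weight) : U ε := RingQuot.mkAlgHom ℂ (Rel ε) (gK μ)

/-- The positive roots `α = α₁`, `α + β`, `β = α₂` of `sl₃`. -/
inductive PosRoot : Type
  | α
  | αβ
  | β

/-- The root vectors `E_γ` for the reduced expression `w₀ = s_β s_α s_β`. -/
def rootE (ε : ℂ) : PosRoot → U ε
  | .α => E ε 0
  | .αβ => -(E ε 1 * E ε 0) + ε⁻¹ • (E ε 0 * E ε 1)
  | .β => E ε 1

/-- The root vectors `F_γ` for the reduced expression `w₀ = s_β s_α s_β`. -/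
def rootF (ε : ℂ) : PosRoot → U ε
  | .α => F ε 0
  | .αβ => -(F ε 0 * F ε 1) + ε • (F ε 1 * F ε 0)
  | .β => F ε 1

/-- The `ℓ`-center `Z_0^Λ(sl₃)`: the subalgebra generated by the `ℓ`-th powers of all root vectors
and of all `K_μ`. -/
def ellCenter (ε : ℂ) (ℓ : ℕ) : Subalgebra ℂ (U ε) :=
  Algebra.adjoin ℂ
    (Set.range (fun γ => rootE ε γ ^ ℓ) ∪ Set.range (fun γ => rootF ε γ ^ ℓ) ∪
      Set.range (fun μ => K ε μ ^ ℓ))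

/-- `ℓ`-characters: the points of `Spec (Z_0^Λ(sl₃))`. -/
abbrev EllChar (ε : ℂ) (ℓ : ℕ) : Type := ellCenter ε ℓ →ₐ[ℂ] ℂ

/-- `E_γ^ℓ` in the `ℓ`-center. -/
def ellE (ε : ℂ) (ℓ : ℕ) (γ : PosRoot) : ellCenter ε ℓ :=
  ⟨rootE ε γ ^ ℓ, Algebra.subset_adjoin (Or.inl (Or.inl ⟨γ, rfl⟩))⟩

/-- `F_γ^ℓ` in the `ℓ`-center. -/
def ellF (ε : ℂ) (ℓ : ℕ) (γ : PosRoot) : ellCenter ε ℓ :=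
  ⟨rootF ε γ ^ ℓ, Algebra.subset_adjoin (Or.inl (Or.inr ⟨γ, rfl⟩))⟩

/-- `K_μ^ℓ` in the `ℓ`-center. -/
def ellK (ε : ℂ) (ℓ : ℕ) (μ : Weight) : ellCenter ε ℓ :=
  ⟨K ε μ ^ ℓ, Algebra.subset_adjoin (Or.inr ⟨μ, rfl⟩)⟩

theorem K_mul (ε : ℂ) (μ ν : Weight) : K ε μ * K ε ν = K ε (μ + ν) := by
  unfold K
  rw [← map_mul]
  exact RingQuot.mkAlgHom_rel ℂ (Rel.K_add μ ν)

theorem K_zero (ε : ℂ) : K ε 0 = 1 := by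
  unfold K
  rw [RingQuot.mkAlgHom_rel ℂ (Rel.K_zero (ε := ε)), map_one]

theorem ellK_mul (ε : ℂ) (ℓ : ℕ) (μ ν : Weight) :
    ellK ε ℓ μ * ellK ε ℓ ν = ellK ε ℓ (μ + ν) := by
  apply Subtype.ext
  have hc : Commute (K ε μ) (K ε ν) := by
    show K ε μ * K ε ν = K ε ν * K ε μ
    rw [K_mul, K_mul, add_comm]
  show K ε μ ^ ℓ * K ε ν ^ ℓ = K ε (μ + ν) ^ ℓ
  rw [← hc.mul_pow, K_mul]

theorem ellK_zero (ε : ℂ) (ℓ : ℕ) : ellK ε ℓ 0 = 1 := by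
  apply Subtype.ext
  show K ε 0 ^ ℓ = 1
  rw [K_zero, one_pow]

/-- The complex group `SL₃(ℂ)`, which is the simply connected group of type `A₂`. -/
abbrev SL3 : Type := Matrix.SpecialLinearGroup (Fin 3) ℂ

/-- The root subgroups `x ↦ exp (x e_γ)` with `e_α = e₁₂`, `e_β = e₂₃`, `e_{α+β} = [e_α, e_β] = e₁₃`. -/
def expPos : PosRoot → ℂ → SL3
  | .α, x => ⟨!![1, x, 0; 0, 1, 0; 0, 0, 1], by simp [Matrix.det_fin_three]⟩
  | .αβ, x => ⟨!![1, 0, x; 0, 1, 0; 0, 0, 1], by simp [Matrix.det_fin_three]⟩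
  | .β, x => ⟨!![1, 0, 0; 0, 1, x; 0, 0, 1], by simp [Matrix.det_fin_three]⟩

/-- The opposite root subgroups `x ↦ exp (x f_γ)` with `f_γ` the transpose of `e_γ`. -/
def expNeg (γ : PosRoot) (x : ℂ) : SL3 := (expPos γ x).transpose

/-- The component `v ∈ U` of an `ℓ`-character: the product of the root subgroups in the
coordinates `((ε - ε⁻¹) E_γ)^ℓ`. -/
def posPart {ε : ℂ} {ℓ : ℕ} (η : EllChar ε ℓ) : SL3 :=
  expPos .α ((ε - ε⁻¹) ^ ℓ * η (ellE ε ℓ .α)) * expPos .αβ ((ε - ε⁻¹) ^ ℓ * η (ellE ε ℓ .αβ)) *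
    expPos .β ((ε - ε⁻¹) ^ ℓ * η (ellE ε ℓ .β))

/-- The component `u ∈ U⁻` of an `ℓ`-character: the product of the opposite root subgroups in the
coordinates `((ε⁻¹ - ε) F_γ)^ℓ`. -/
def negPart {ε : ℂ} {ℓ : ℕ} (η : EllChar ε ℓ) : SL3 :=
  expNeg .β ((ε⁻¹ - ε) ^ ℓ * η (ellF ε ℓ .β)) * expNeg .αβ ((ε⁻¹ - ε) ^ ℓ * η (ellF ε ℓ .αβ)) *
    expNeg .α ((ε⁻¹ - ε) ^ ℓ * η (ellF ε ℓ .α))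

/-- The component `t ∈ T_Λ` of an `ℓ`-character: the diagonal matrix `t` with
`μ(t) = η (K_μ^ℓ)` for all `μ ∈ Λ`; its diagonal entries are the values of the weights
`λ₁`, `λ₂ - λ₁`, `-λ₂` of the standard representation. -/
def torusPart {ε : ℂ} {ℓ : ℕ} (η : EllChar ε ℓ) : SL3 :=
  ⟨Matrix.diagonal ![η (ellK ε ℓ ![1, 0]), η (ellK ε ℓ ![-1, 1]), η (ellK ε ℓ ![0, -1])], by
    rw [Matrix.det_diagonal, Fin.prod_univ_three]
    show η (ellK ε ℓ ![1, 0]) * η (ellK ε ℓ ![-1, 1]) * η (ellK ε ℓ ![0, -1]) = 1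
    rw [← map_mul, ← map_mul, ellK_mul, ellK_mul, ← map_one η, ← ellK_zero]
    congr 2
    ext i
    fin_cases i <;> rfl⟩

/-- The map `π_Λ : Spec (Z_0^Λ(sl₃)) → B⁻B ⊆ SL₃(ℂ)`: it sends the point
`(x, y) = (t⁻¹u, tv)` to `x⁻¹y`. -/
def piMap {ε : ℂ} {ℓ : ℕ} (η : EllChar ε ℓ) : SL3 :=
  ((torusPart η)⁻¹ * negPart η)⁻¹ * (torusPart η * posPart η)

/-- Central `ℓ`-characters: those `η` with `π_Λ(η) ∈ Z(SL₃(ℂ))`. -/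
def IsCentralChar {ε : ℂ} {ℓ : ℕ} (η : EllChar ε ℓ) : Prop :=
  piMap η ∈ Subgroup.center SL3

/-- The reduced quantized enveloping algebra `U_η^Λ(sl₃)`, the quotient of `U_ε^Λ(sl₃)` by
the ideal generated by `ker η`. -/
abbrev Ured {ε : ℂ} {ℓ : ℕ} (η : EllChar ε ℓ) : Type :=
  RingQuot (fun a b : U ε => ∃ z : ellCenter ε ℓ, η z = 0 ∧ a = (z : U ε) ∧ b = 0)

/-- The canonical projection `U_ε^Λ(sl₃) → U_η^Λ(sl₃)`. -/
def toUred {ε : ℂ} {ℓ : ℕ} (η : EllChar ε ℓ) : U ε →ₐ[ℂ] Ured η :=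
  RingQuot.mkAlgHom ℂ (fun a b : U ε => ∃ z : ellCenter ε ℓ, η z = 0 ∧ a = (z : U ε) ∧ b = 0)

/-- A `U_ε^Λ(sl₃)`-module has `ℓ`-character `η` if the `ℓ`-center acts on it through `η`. -/
def HasEllChar {ε : ℂ} {ℓ : ℕ} (η : EllChar ε ℓ) (V : Type*) [AddCommGroup V] [Module ℂ V]
    [Module (U ε) V] : Prop :=
  ∀ (z : ellCenter ε ℓ) (v : V), (z : U ε) • v = η z • v

/-- The dimension of the conjugacy class of `g` in `SL₃(ℂ)` as an algebraic variety: the Krull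
dimension of the coordinate ring of its Zariski closure in the affine space of matrices. -/
def classDim (g : SL3) : WithBot ℕ∞ :=
  ringKrullDim (MvPolynomial (Fin 3 × Fin 3) ℂ ⧸
    MvPolynomial.vanishingIdeal ℂ
      ((fun (h : SL3) (p : Fin 3 × Fin 3) => (h : Matrix (Fin 3) (Fin 3) ℂ) p.1 p.2) ''
        conjugatesOf g))

/-- A `U_η^Λ(sl₃)`-module `V` is small if `dim V = ℓ ^ (½ dim O)`, where `O` is the conjugacy
class of `π_Λ(η)`. -/
def IsSmallModule {ε : ℂ} {ℓ : ℕ} (η : EllChar ε ℓ) (V : Type*) [AddCommGroup V] [Module ℂ V]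
    [Module (Ured η) V] [IsScalarTower ℂ (Ured η) V] : Prop :=
  ∃ d : ℕ, classDim (piMap η) = ((2 * d : ℕ) : WithBot ℕ∞) ∧ Module.finrank ℂ V = ℓ ^ d

end QuantumSL3

end

noncomputable section

namespace QuantumSL3

/-! If `π_Λ(η) = c` is scalar, comparing `u · c` with `t² v` forces `t² = c` and kills all `E_γ^ℓ`,
`F_γ^ℓ` (`IsCentralChar.spec`). So `K_{λ₁}^{2ℓ}` acts by `c`, and each `E_i` acts nilpotently.

In dimension at most 2 nilpotents square to zero, so the Serre relation collapses to `E_α E_β E_α =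
0`, which makes `E_β` a multiple of `E_α` unless `E_α = 0`. The two have different weights, hence
some `E_i` is zero (`exists_map_E_eq_zero`). The commutation relations then give `K_{α_i}² = 1` for
both simple roots, and `3λ₁ = 2α + β` gives `K_{λ₁}⁶ = 1` (`map_K_pow_six`). As `3 ∣ ℓ`, this yields
`c = 1`. That is the bound in (2). Part (1) follows because a central class is a point, so a small
module would be one-dimensional.

For (3), the given matrices generate all of `Mat₃`, which gives irreducibility, and `K_μ³` is
scalar. On this module `K_{-α_i}E_i` and `F_iK_{α_i}` are multiples of `E_i` and `F_i`, so the dual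
is the transpose of a Chevalley twist. -/

theorem K_mul_E (ε : ℂ) (μ : Weight) (i : Fin 2) :
    K ε μ * E ε i = ε ^ μ i • (E ε i * K ε μ) := by
  unfold K E
  rw [← map_mul, ← map_mul, ← map_smul]
  exact RingQuot.mkAlgHom_rel ℂ (Rel.K_E μ i)

theorem K_mul_F (ε : ℂ) (μ : Weight) (i : Fin 2) :
    K ε μ * F ε i = ε ^ (-μ i) • (F ε i * K ε μ) := by
  unfold K F
  rw [← map_mul, ← map_mul, ← map_smul]
  exact RingQuot.mkAlgHom_rel ℂ (Rel.K_F μ i)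

theorem E_mul_F_sub (ε : ℂ) (i : Fin 2) :
    E ε i * F ε i - F ε i * E ε i =
      (ε - ε⁻¹)⁻¹ • (K ε (simpleRoot i) - K ε (-simpleRoot i)) := by
  unfold K E F
  rw [← map_mul, ← map_mul, ← map_sub, ← map_sub, ← map_smul]
  exact RingQuot.mkAlgHom_rel ℂ (Rel.E_F_same i)

theorem serre_E (ε : ℂ) {i j : Fin 2} (h : i ≠ j) :
    E ε i ^ 2 * E ε j - (ε + ε⁻¹) • (E ε i * E ε j * E ε i) + E ε j * E ε i ^ 2 = 0 := by
  unfold E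
  simpa only [map_add, map_sub, map_mul, map_pow, map_smul, map_zero] using
    RingQuot.mkAlgHom_rel ℂ (Rel.serre_E (ε := ε) i j h)

theorem K_pow (ε : ℂ) (μ : Weight) (n : ℕ) : K ε μ ^ n = K ε (n • μ) := by
  induction n with
  | zero => rw [pow_zero, zero_smul, K_zero]
  | succ n ih => rw [pow_succ, ih, K_mul, succ_nsmul]

theorem K_mul_K_neg (ε : ℂ) (μ : Weight) : K ε μ * K ε (-μ) = 1 := by
  rw [K_mul, add_neg_cancel, K_zero]

/-- The universal property of `U ε`. -/
def liftU (ε : ℂ) {A : Type*} [Ring A] [Algebra ℂ A] (e f : Fin 2 → A) (k : Weight → A)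
    (k_zero : k 0 = 1) (k_add : ∀ μ ν, k μ * k ν = k (μ + ν))
    (k_e : ∀ μ i, k μ * e i = ε ^ μ i • (e i * k μ))
    (k_f : ∀ μ i, k μ * f i = ε ^ (-μ i) • (f i * k μ))
    (e_f : ∀ i, e i * f i - f i * e i = (ε - ε⁻¹)⁻¹ • (k (simpleRoot i) - k (-simpleRoot i)))
    (e_f' : ∀ i j, i ≠ j → e i * f j - f j * e i = 0)
    (se : ∀ i j, i ≠ j →
      e i ^ 2 * e j - (ε + ε⁻¹) • (e i * e j * e i) + e j * e i ^ 2 = 0)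
    (sf : ∀ i j, i ≠ j →
      f i ^ 2 * f j - (ε + ε⁻¹) • (f i * f j * f i) + f j * f i ^ 2 = 0) :
    U ε →ₐ[ℂ] A :=
  RingQuot.liftAlgHom ℂ ⟨FreeAlgebra.lift ℂ (fun g => match g with
    | .E i => e i
    | .F i => f i
    | .K μ => k μ), by
      intro x y h
      cases h with
      | K_zero => simpa using k_zero
      | K_add μ ν => simpa using k_add μ ν
      | K_E μ i => simpa [pairing] using k_e μ i
      | K_F μ i => simpa [pairing] using k_f μ i
      | E_F_same i => simpa using e_f i
      | E_F_diff i j h => simpa using e_f' i j h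
      | serre_E i j h => simpa using se i j h
      | serre_F i j h => simpa using sf i j h⟩

section Parameter

variable {ε : ℂ} {ℓ : ℕ}

theorem ne_zero_of_primitiveRoot (hodd : Odd ℓ) (hε : IsPrimitiveRoot ε ℓ) : ε ≠ 0 :=
  hε.ne_zero (hodd.pos.ne')

theorem sq_ne_one_of_primitiveRoot (h3 : 3 ∣ ℓ) (hε : IsPrimitiveRoot ε ℓ) :
    ε ^ 2 ≠ 1 := fun h => by
  have h1 := hε.dvd_of_pow_eq_one 2 h
  have := Nat.le_of_dvd (by norm_num) (h3.trans h1)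
  omega

theorem pow_four_ne_one_of_primitiveRoot (h3 : 3 ∣ ℓ)
    (hε : IsPrimitiveRoot ε ℓ) : ε ^ 4 ≠ 1 := fun h => by
  have h1 := h3.trans (hε.dvd_of_pow_eq_one 4 h)
  omega

theorem sub_inv_ne_zero_of_primitiveRoot (hodd : Odd ℓ) (h3 : 3 ∣ ℓ)
    (hε : IsPrimitiveRoot ε ℓ) : ε - ε⁻¹ ≠ 0 := fun h => by
  have h0 := ne_zero_of_primitiveRoot hodd hε
  apply sq_ne_one_of_primitiveRoot h3 hε
  field_simp at h
  linear_combination h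

theorem add_inv_ne_zero_of_primitiveRoot (hodd : Odd ℓ) (h3 : 3 ∣ ℓ)
    (hε : IsPrimitiveRoot ε ℓ) : ε + ε⁻¹ ≠ 0 := fun h => by
  have h0 := ne_zero_of_primitiveRoot hodd hε
  apply pow_four_ne_one_of_primitiveRoot h3 hε
  field_simp at h
  linear_combination (ε ^ 2 - 1) * h

end Parameter

/-! ### Central characters and the dimension of their conjugacy classes -/

section Central

variable {ε : ℂ} {ℓ : ℕ} (η : EllChar ε ℓ)

theorem coe_expPos_α (x : ℂ) :
    (expPos .α x : Matrix (Fin 3) (Fin 3) ℂ) = !![1, x, 0; 0, 1, 0; 0, 0, 1] := rfl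

theorem coe_expPos_αβ (x : ℂ) :
    (expPos .αβ x : Matrix (Fin 3) (Fin 3) ℂ) = !![1, 0, x; 0, 1, 0; 0, 0, 1] := rfl

theorem coe_expPos_β (x : ℂ) :
    (expPos .β x : Matrix (Fin 3) (Fin 3) ℂ) = !![1, 0, 0; 0, 1, x; 0, 0, 1] := rfl

theorem coe_posPart : (posPart η : Matrix (Fin 3) (Fin 3) ℂ) =
    !![1, (ε - ε⁻¹) ^ ℓ * η (ellE ε ℓ .α),
        (ε - ε⁻¹) ^ ℓ * η (ellE ε ℓ .αβ) +
          (ε - ε⁻¹) ^ ℓ * η (ellE ε ℓ .α) * ((ε - ε⁻¹) ^ ℓ * η (ellE ε ℓ .β));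
      0, 1, (ε - ε⁻¹) ^ ℓ * η (ellE ε ℓ .β); 0, 0, 1] := by
  simp only [posPart, Matrix.SpecialLinearGroup.coe_mul, coe_expPos_α,
    coe_expPos_αβ, coe_expPos_β]
  ext i j
  fin_cases i <;> fin_cases j <;> simp [Matrix.mul_apply, Fin.sum_univ_three, add_comm]

theorem coe_negPart : (negPart η : Matrix (Fin 3) (Fin 3) ℂ) =
    !![1, 0, 0; (ε⁻¹ - ε) ^ ℓ * η (ellF ε ℓ .α), 1, 0;
      (ε⁻¹ - ε) ^ ℓ * η (ellF ε ℓ .αβ) +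
        (ε⁻¹ - ε) ^ ℓ * η (ellF ε ℓ .β) * ((ε⁻¹ - ε) ^ ℓ * η (ellF ε ℓ .α)),
      (ε⁻¹ - ε) ^ ℓ * η (ellF ε ℓ .β), 1] := by
  simp only [negPart, Matrix.SpecialLinearGroup.coe_mul, expNeg,
    Matrix.SpecialLinearGroup.coe_transpose, coe_expPos_α, coe_expPos_αβ, coe_expPos_β]
  ext i j
  fin_cases i <;> fin_cases j <;> simp [Matrix.mul_apply, Fin.sum_univ_three]

/-- This inverse-free form of `π_Λ(η) = u⁻¹t²v` can be compared entry by entry. -/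
theorem negPart_mul_piMap : negPart η * piMap η = torusPart η * torusPart η * posPart η := by
  unfold piMap
  group

/-- A central `ℓ`-character kills the `ℓ`-th powers of the root vectors. -/
theorem IsCentralChar.spec (hne : ε - ε⁻¹ ≠ 0) (h : IsCentralChar η) :
    ∃ c : ℂ, c ^ 3 = 1 ∧ (piMap η : Matrix (Fin 3) (Fin 3) ℂ) = Matrix.scalar (Fin 3) c ∧
      η (ellK ε ℓ ![1, 0]) ^ 2 = c ∧ (∀ γ, η (ellE ε ℓ γ) = 0) ∧ ∀ γ, η (ellF ε ℓ γ) = 0 := by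
  obtain ⟨c, hc, hcm⟩ := Matrix.SpecialLinearGroup.mem_center_iff.1 h
  have hc3 : c ^ 3 = 1 := by simpa using hc
  have hc0 : c ≠ 0 := by rintro rfl; simp at hc3
  have hne' : ε⁻¹ - ε ≠ 0 := fun h => hne (by linear_combination -h)
  -- With `piMap η` scalar, a lower triangular matrix equals an upper triangular one, so both are
  -- diagonal.
  have key := congrArg (Subtype.val) (negPart_mul_piMap η)
  simp only [Matrix.SpecialLinearGroup.coe_mul, coe_posPart, coe_negPart, ← hcm] at key
  have e := fun i j => congrFun (congrFun key i) j
  have h00 := e 0 0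
  have h01 := e 0 1
  have h02 := e 0 2
  have h12 := e 1 2
  have h11 := e 1 1
  have h10 := e 1 0
  have h20 := e 2 0
  have h21 := e 2 1
  simp [Matrix.mul_apply, torusPart, Matrix.diagonal_apply, hc0, hne, hne',
    Matrix.scalar_apply] at h00 h01 h02 h10 h11 h12 h20 h21
  have hk0 : η (ellK ε ℓ ![1, 0]) ≠ 0 := fun h => hc0 (by rw [h00, h, zero_mul])
  have hk1 : η (ellK ε ℓ ![-1, 1]) ≠ 0 := fun h => hc0 (by rw [h11, h, zero_mul])
  simp [hk0, hk1] at h01 h12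
  -- Corner entries also contain a product of simple-root coordinates, which has to vanish first.
  simp [hk0, h01, hne] at h02
  simp [h10, hne'] at h20
  refine ⟨c, hc3, hcm.symm, by rw [sq, h00], ?_, ?_⟩ <;> rintro (_ | _ | _) <;> assumption

/-- The class is one point, whose vanishing ideal is maximal, so its coordinate ring is a field. -/
theorem classDim_of_mem_center {g : SL3} (hg : g ∈ Subgroup.center SL3) : classDim g = 0 := by
  have h : conjugatesOf g = {g} := by
    ext x
    simp only [conjugatesOf, Set.mem_ofPred_eq, Set.mem_singleton_iff, isConj_iff]
    constructor
    · rintro ⟨c, rfl⟩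
      rw [Subgroup.mem_center_iff.1 hg c, mul_inv_cancel_right]
    · rintro rfl
      exact ⟨1, by simp⟩
  unfold classDim
  rw [h, Set.image_singleton]
  let _ := Ideal.Quotient.field (MvPolynomial.vanishingIdeal ℂ
    {fun p : Fin 3 × Fin 3 => (g : Matrix (Fin 3) (Fin 3) ℂ) p.1 p.2})
  exact ringKrullDim_eq_zero_of_field _

end Central

/-! ### The lower bound on dimension -/

section SmallDimension

theorem sq_eq_zero_of_finrank_le_two {V : Type*} [AddCommGroup V] [Module ℂ V]
    [FiniteDimensional ℂ V] (hV : Module.finrank ℂ V ≤ 2) {f : Module.End ℂ V} {n : ℕ}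
    (hf : f ^ n = 0) : f ^ 2 = 0 := by
  -- Kernels of powers are stable from exponent `finrank` on; adding 2 reaches that range even for
  -- small `n`.
  have h1 : f ^ (n + 2) = 0 := by rw [pow_add, hf, zero_mul]
  have h2 := Module.End.ker_pow_eq_ker_pow_finrank_of_le (f := f) (m := n + 2) (by omega)
  have h3 := Module.End.ker_pow_eq_ker_pow_finrank_of_le (f := f) (m := 2) hV
  rw [← LinearMap.ker_eq_top, h3, ← h2, h1, LinearMap.ker_zero]

/-- If `f v ≠ 0`, then `v, f v` is a basis and `ker f` is the line of `f v`. The condition `fgf = 0`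
puts `g (f v)` on that line, and nilpotency of `g` makes it zero. Then `g² v = 0` removes the
`v`-component of `g v`. -/
theorem eq_smul_of_mul_mul_eq_zero {V : Type*} [AddCommGroup V] [Module ℂ V]
    [FiniteDimensional ℂ V] (hV : Module.finrank ℂ V ≤ 2) {f g : Module.End ℂ V}
    (hf : f ^ 2 = 0) (hg : g ^ 2 = 0) (hfg : f * g * f = 0) (h0 : f ≠ 0) :
    ∃ b : ℂ, g = b • f := by
  obtain ⟨v, hv⟩ : ∃ v, f v ≠ 0 := by
    by_contra! h
    exact h0 (LinearMap.ext h)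
  have hff : ∀ x, f (f x) = 0 := fun x => by
    simpa [sq] using LinearMap.congr_fun hf x
  have hgg : ∀ x, g (g x) = 0 := fun x => by
    simpa [sq] using LinearMap.congr_fun hg x
  have hfgf : f (g (f v)) = 0 := by simpa using LinearMap.congr_fun hfg v
  have hli : LinearIndependent ℂ ![v, f v] := by
    rw [LinearIndependent.pair_iff]
    intro s t h
    have h1 := congrArg f h
    simp [hff, hv] at h1
    simpa [h1, hv] using h
  have hspan : ∀ x, ∃ a b : ℂ, a • v + b • f v = x := fun x => by
    have h2 := hli.fintype_card_le_finrank
    have := hli.span_eq_top_of_card_eq_finrank' (by simp at h2 ⊢; omega)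
    have hx : x ∈ Submodule.span ℂ (Set.range ![v, f v]) := by rw [this]; trivial
    rw [Matrix.range_cons_cons_empty] at hx
    exact Submodule.mem_span_pair.1 hx
  have hgw : g (f v) = 0 := by
    obtain ⟨a, c, h⟩ := hspan (g (f v))
    have ha : a = 0 := by
      rw [← h] at hfgf
      simpa [hff, hv] using hfgf
    have h2 := hgg (f v)
    rw [← h, ha, zero_smul, zero_add, map_smul, ← h, ha, zero_smul, zero_add, smul_smul] at h2
    have hc : c = 0 := by simpa [hv] using h2
    rw [← h, ha, hc, zero_smul, zero_smul, add_zero]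
  obtain ⟨a, b, h⟩ := hspan (g v)
  have ha : a = 0 := by
    have h2 := hgg v
    rw [← h, map_add, map_smul, map_smul, hgw, smul_zero, add_zero] at h2
    rcases smul_eq_zero.1 h2 with h3 | h3
    · exact h3
    · have h4 := congrArg f h
      simpa [h3, hff, hv] using h4
  refine ⟨b, LinearMap.ext fun x => ?_⟩
  obtain ⟨s, t, rfl⟩ := hspan x
  simp [hgw, hff, ← h, ha, smul_smul, mul_comm]

variable {ε : ℂ} {ℓ : ℕ} {V : Type*} [AddCommGroup V] [Module ℂ V]

variable {A : Type*} [Ring A] [Algebra ℂ A] (ρ : U ε →ₐ[ℂ] A)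

/-- The commutator of `E_i` and `F_i` vanishes, so `K_{α_i}` equals its own inverse. -/
theorem map_K_sq_of_map_E_eq_zero (hne : ε - ε⁻¹ ≠ 0) {i : Fin 2} (h : ρ (E ε i) = 0) :
    ρ (K ε (simpleRoot i)) ^ 2 = 1 := by
  have h1 := congrArg ρ (E_mul_F_sub ε i)
  simp only [map_sub, map_mul, map_smul, h, zero_mul, mul_zero, sub_zero] at h1
  have h2 : ρ (K ε (simpleRoot i)) = ρ (K ε (-simpleRoot i)) :=
    sub_eq_zero.1 ((smul_eq_zero_iff_right (inv_ne_zero hne)).1 h1.symm)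
  rw [sq]
  nth_rw 2 [h2]
  rw [← map_mul, K_mul_K_neg, map_one]

/-- `K_{2α_i}` acts as 1, yet conjugation by it scales `E_j` by `ε⁻² ≠ 1`. -/
theorem map_E_eq_zero_of_map_K_sq (h1 : ε ^ 2 ≠ 1) {i j : Fin 2} (hij : i ≠ j)
    (h : ρ (K ε (simpleRoot i)) ^ 2 = 1) : ρ (E ε j) = 0 := by
  have h2 := congrArg ρ (K_mul_E ε (2 • simpleRoot i) j)
  rw [← K_pow] at h2
  simp only [map_mul, map_smul, map_pow, h, one_mul, mul_one] at h2
  have h3 : (2 • simpleRoot i) j = -2 := by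
    fin_cases i <;> fin_cases j <;> simp_all [simpleRoot]
  rw [h3, eq_comm, ← sub_eq_zero] at h2
  have h4 : (ε ^ (-2 : ℤ) - 1) • ρ (E ε j) = 0 := by rw [sub_smul, one_smul, h2]
  refine (smul_eq_zero_iff_right ?_).1 h4
  rw [sub_ne_zero, zpow_neg]
  intro h5
  exact h1 (by exact_mod_cast inv_eq_one.1 h5)

theorem map_K_pow_six (hne : ε - ε⁻¹ ≠ 0) (h1 : ε ^ 2 ≠ 1) {i : Fin 2}
    (h : ρ (E ε i) = 0) : ρ (K ε ![1, 0]) ^ 6 = 1 := by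
  have key : ∀ j, ρ (K ε (simpleRoot j)) ^ 2 = 1 := fun j => by
    by_cases hij : i = j
    · exact map_K_sq_of_map_E_eq_zero ρ hne (hij ▸ h)
    · exact map_K_sq_of_map_E_eq_zero ρ hne
        (map_E_eq_zero_of_map_K_sq ρ h1 hij (map_K_sq_of_map_E_eq_zero ρ hne h))
  -- This is `6λ₁ = 4α + 2β`.
  have h2 : K ε ![1, 0] ^ 6 = (K ε (simpleRoot 0) ^ 2) ^ 2 * K ε (simpleRoot 1) ^ 2 := by
    simp only [K_pow, K_mul]
    congr 1
    ext j
    fin_cases j <;> simp [simpleRoot]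
  rw [← map_pow, h2, map_mul, map_pow, map_pow, map_pow, key, key, one_pow, one_mul]

theorem exists_map_E_eq_zero [FiniteDimensional ℂ V] (hV : Module.finrank ℂ V ≤ 2)
    (hodd : Odd ℓ) (h3 : 3 ∣ ℓ) (hε : IsPrimitiveRoot ε ℓ)
    (ρ : U ε →ₐ[ℂ] Module.End ℂ V) (hE : ∀ i, ρ (E ε i) ^ ℓ = 0) :
    ∃ i, ρ (E ε i) = 0 := by
  by_contra! hcon
  have hsq := fun i => sq_eq_zero_of_finrank_le_two hV (hE i)
  have hs := congrArg ρ (serre_E ε (i := 0) (j := 1) (by decide))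
  simp only [map_add, map_sub, map_mul, map_pow, map_smul, map_zero, hsq, zero_mul, mul_zero,
    add_zero, zero_sub, neg_eq_zero] at hs
  obtain ⟨b, hb⟩ := eq_smul_of_mul_mul_eq_zero hV (hsq 0) (hsq 1)
    ((smul_eq_zero_iff_right (add_inv_ne_zero_of_primitiveRoot hodd h3 hε)).1 hs) (hcon 0)
  -- `K_{λ₁}` commutes with `E_β` but scales `E_α` by `ε ≠ 1`, so proportionality forces `b = 0`.
  have k0 := congrArg ρ (K_mul_E ε ![1, 0] 0)
  have k1 := congrArg ρ (K_mul_E ε ![1, 0] 1)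
  simp only [map_mul, map_smul, Matrix.cons_val_zero, Matrix.cons_val_one, zpow_one, zpow_zero,
    one_smul, hb, mul_smul_comm, smul_mul_assoc] at k0 k1
  rw [k0, smul_smul, ← sub_eq_zero, ← sub_smul] at k1
  have hK : ρ (E ε 0) * ρ (K ε ![1, 0]) ≠ 0 := fun h => hcon 0 (by
    have := congrArg (· * ρ (K ε (-![1, 0]))) h
    simpa only [mul_assoc, ← map_mul ρ, K_mul_K_neg, map_one, mul_one, zero_mul] using this)
  have hb0 := (smul_eq_zero.1 k1).resolve_right hK
  have hε1 : ε ≠ 1 := fun h => sq_ne_one_of_primitiveRoot h3 hε (by rw [h, one_pow])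
  have : b * (ε - 1) = 0 := by linear_combination hb0
  have hb' := (mul_eq_zero.1 this).resolve_right (sub_ne_zero.2 hε1)
  exact hcon 1 (by rw [hb, hb', zero_smul])

/-- A nonzero module with a central `ℓ`-character that does not map to `1` has dimension at
least `3`. -/
theorem two_lt_finrank [FiniteDimensional ℂ V] [Nontrivial V] [Module (U ε) V]
    [IsScalarTower ℂ (U ε) V] (hodd : Odd ℓ) (h3 : 3 ∣ ℓ) (hε : IsPrimitiveRoot ε ℓ)
    (η : EllChar ε ℓ) (hc : IsCentralChar η) (h1 : piMap η ≠ 1) (hη : HasEllChar η V) :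
    2 < Module.finrank ℂ V := by
  by_contra! hV
  have hne := sub_inv_ne_zero_of_primitiveRoot hodd h3 hε
  obtain ⟨c, -, hcm, hK, hE, -⟩ := hc.spec η hne
  let ρ : U ε →ₐ[ℂ] Module.End ℂ V := Algebra.lsmul ℂ ℂ V
  have hρ : ∀ z : ellCenter ε ℓ, ρ z = η z • 1 := fun z => LinearMap.ext fun v => hη z v
  obtain ⟨i, hi⟩ := exists_map_E_eq_zero hV hodd h3 hε ρ (fun i => by
    rw [← map_pow]
    fin_cases i
    · exact (hρ (ellE ε ℓ .α)).trans (by rw [hE, zero_smul])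
    · exact (hρ (ellE ε ℓ .β)).trans (by rw [hE, zero_smul]))
  have h6 := map_K_pow_six ρ hne (sq_ne_one_of_primitiveRoot h3 hε) hi
  -- Divisibility of `ℓ` by 3 makes `K_{λ₁}^{2ℓ}` a power of `K_{λ₁}⁶ = 1`.
  obtain ⟨m, rfl⟩ := h3
  have h7 : ρ (ellK ε (3 * m) ![1, 0]) ^ 2 = 1 := by
    change ρ (K ε ![1, 0] ^ (3 * m)) ^ 2 = 1
    rw [map_pow, ← pow_mul, show 3 * m * 2 = 6 * m by ring, pow_mul, h6, one_pow]
  rw [hρ, smul_pow, one_pow, hK] at h7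
  have hc1 : c = 1 := by
    have h8 : (c - 1) • (1 : Module.End ℂ V) = 0 := by rw [sub_smul, h7, one_smul, sub_self]
    exact sub_eq_zero.1 ((smul_eq_zero.1 h8).resolve_right one_ne_zero)
  exact h1 (Subtype.ext (by rw [hcm, hc1, map_one]; rfl))

end SmallDimension

/-! ### From a representation to its central character and simple module -/

section Modules

variable {ε : ℂ} {ℓ : ℕ}

theorem coe_piMap_of_eq_zero (η : EllChar ε ℓ) (hE : ∀ γ, η (ellE ε ℓ γ) = 0)
    (hF : ∀ γ, η (ellF ε ℓ γ) = 0) {a : ℂ} (h0 : η (ellK ε ℓ ![1, 0]) = a)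
    (h1 : η (ellK ε ℓ ![-1, 1]) = a) (h2 : η (ellK ε ℓ ![0, -1]) = a) :
    (piMap η : Matrix (Fin 3) (Fin 3) ℂ) = Matrix.scalar (Fin 3) (a ^ 2) := by
  have hp : posPart η = 1 := Subtype.ext (by
    rw [coe_posPart, Matrix.SpecialLinearGroup.coe_one, Matrix.one_fin_three]; simp [hE])
  have hn : negPart η = 1 := Subtype.ext (by
    rw [coe_negPart, Matrix.SpecialLinearGroup.coe_one, Matrix.one_fin_three]; simp [hF])
  have h := negPart_mul_piMap η
  rw [hp, hn, one_mul, mul_one] at h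
  rw [h, Matrix.SpecialLinearGroup.coe_mul]
  ext i j
  fin_cases i <;> fin_cases j <;> simp [torusPart, h0, h1, h2, sq]

/-- If the generators of the `ℓ`-center act by scalars, with the root vectors nilpotent, then the
`ℓ`-center acts through an `ℓ`-character, and that `ℓ`-character is central. -/
theorem exists_central_ellChar {A : Type*} [Ring A] [Nontrivial A] [Algebra ℂ A]
    (ρ : U ε →ₐ[ℂ] A) (hE : ∀ γ, ρ (rootE ε γ) ^ ℓ = 0) (hF : ∀ γ, ρ (rootF ε γ) ^ ℓ = 0)
    {a : ℂ} (ha : a ^ 3 = 1) (ha1 : a ≠ 1)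
    (hK : ∀ μ, ρ (K ε μ) ^ ℓ = algebraMap ℂ A (a ^ (μ 0 + 2 * μ 1))) :
    ∃ η : EllChar ε ℓ, IsCentralChar η ∧ piMap η ≠ 1 ∧ η (ellK ε ℓ ![1, 0] ^ 2) = a ^ 2 ∧
      ∀ z : ellCenter ε ℓ, ρ z = algebraMap ℂ A (η z) := by
  -- Elements acting by scalars form a subalgebra, so generators suffice.
  have hle : ellCenter ε ℓ ≤ (⊥ : Subalgebra ℂ A).comap ρ := by
    refine Algebra.adjoin_le ?_
    rintro _ ((⟨γ, rfl⟩ | ⟨γ, rfl⟩) | ⟨μ, rfl⟩)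
    · change ρ (rootE ε γ ^ ℓ) ∈ (⊥ : Subalgebra ℂ A)
      rw [map_pow, hE]
      exact zero_mem _
    · change ρ (rootF ε γ ^ ℓ) ∈ (⊥ : Subalgebra ℂ A)
      rw [map_pow, hF]
      exact zero_mem _
    · change ρ (K ε μ ^ ℓ) ∈ (⊥ : Subalgebra ℂ A)
      rw [map_pow, hK]
      exact Subalgebra.algebraMap_mem _ _
  let η : EllChar ε ℓ := (Algebra.botEquiv ℂ A : _ →ₐ[ℂ] ℂ).comp
    ((ρ.comp (ellCenter ε ℓ).val).codRestrict ⊥ fun z => hle z.2)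
  have hη : ∀ z : ellCenter ε ℓ, ρ z = algebraMap ℂ A (η z) := fun z => by
    have h := congrArg Subtype.val ((Algebra.botEquiv ℂ A).symm_apply_apply
      ((ρ.comp (ellCenter ε ℓ).val).codRestrict ⊥ (fun z => hle z.2) z))
    rw [Algebra.botEquiv_symm_apply] at h
    exact h.symm
  have hval : ∀ (z : ellCenter ε ℓ) (c : ℂ), ρ z = algebraMap ℂ A c → η z = c := fun z c h =>
    (algebraMap ℂ A).injective ((hη z).symm.trans h)
  have hηK : ∀ μ, η (ellK ε ℓ μ) = a ^ (μ 0 + 2 * μ 1) := fun μ =>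
    hval _ _ ((map_pow ρ _ _).trans (hK μ))
  -- The weights `λ₁`, `λ₂ - λ₁`, `-λ₂` have exponents 1, 1, -2, which all give `a` since `a³ = 1`;
  -- hence `t` is the scalar `a`.
  have h0 : η (ellK ε ℓ ![1, 0]) = a := by simp [hηK]
  have hpi := coe_piMap_of_eq_zero η
    (fun γ => hval _ _ (by rw [map_zero]; exact (map_pow ρ _ _).trans (hE γ)))
    (fun γ => hval _ _ (by rw [map_zero]; exact (map_pow ρ _ _).trans (hF γ)))
    h0 (by simp [hηK]) (by
      simp [hηK, zpow_neg]
      exact inv_eq_of_mul_eq_one_right (by linear_combination ha))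
  refine ⟨η, Matrix.SpecialLinearGroup.mem_center_iff.2 ⟨a ^ 2, ?_, hpi.symm⟩, fun h => ?_,
    by rw [map_pow, h0], hη⟩
  · rw [Fintype.card_fin, ← pow_mul, mul_comm, pow_mul, ha, one_pow]
  · rw [h] at hpi
    have h00 := congrFun (congrFun hpi 0) 0
    simp at h00
    exact ha1 (by linear_combination ha + a * h00)

/-- A surjective representation on `V` through which the `ℓ`-center acts by `η` makes `V` a simple
module over the reduced algebra. -/
theorem exists_simple_module {V : Type*} [AddCommGroup V] [Module ℂ V] [Nontrivial V]
    (ρ : U ε →ₐ[ℂ] Module.End ℂ V) (hρ : Function.Surjective ρ) (η : EllChar ε ℓ)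
    (hη : ∀ z : ellCenter ε ℓ, ρ z = algebraMap ℂ _ (η z)) :
    ∃ (_ : Module (Ured η) V) (_ : IsScalarTower ℂ (Ured η) V),
      IsSimpleModule (Ured η) V ∧ ∀ (x : U ε) (v : V), toUred η x • v = ρ x v := by
  let Θ : Ured η →ₐ[ℂ] Module.End ℂ V := RingQuot.liftAlgHom ℂ ⟨ρ, by
    rintro _ _ ⟨z, hz, rfl, rfl⟩
    rw [hη, hz, map_zero, map_zero]⟩
  have hΘ : ∀ x, Θ (toUred η x) = ρ x := fun x => RingQuot.liftAlgHom_mkAlgHom_apply _ _ _ _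
  let m : Module (Ured η) V := Module.compHom V Θ.toRingHom
  have hm : ∀ (a : Ured η) (v : V), a • v = Θ a v := fun _ _ => rfl
  refine ⟨m, ⟨fun c a v => ?_⟩, ?_, fun x v => ?_⟩
  · rw [hm, hm, map_smul, LinearMap.smul_apply]
  · have : RingHomSurjective Θ.toRingHom := ⟨fun y => by
      obtain ⟨x, rfl⟩ := hρ y
      exact ⟨toUred η x, hΘ x⟩⟩
    -- `V` is simple over its endomorphism ring; the identity, semilinear along the surjection `Θ`,
    -- transfers this.
    let l : V →ₛₗ[Θ.toRingHom] V :=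
      { toFun := id, map_add' := fun _ _ => rfl, map_smul' := fun _ _ => rfl }
    exact (LinearMap.isSimpleModule_iff_of_bijective l Function.bijective_id).2 inferInstance
  · rw [hm, hΘ]

end Modules

/-! ### The three-dimensional representation and the Chevalley twist -/

section Standard

theorem E_mul_F_comm (ε : ℂ) {i j : Fin 2} (h : i ≠ j) :
    E ε i * F ε j - F ε j * E ε i = 0 := by
  unfold E F
  simpa only [map_sub, map_mul, map_zero] using
    RingQuot.mkAlgHom_rel ℂ (Rel.E_F_diff (ε := ε) i j h)

theorem serre_F (ε : ℂ) {i j : Fin 2} (h : i ≠ j) :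
    F ε i ^ 2 * F ε j - (ε + ε⁻¹) • (F ε i * F ε j * F ε i) + F ε j * F ε i ^ 2 = 0 := by
  unfold F
  simpa only [map_add, map_sub, map_mul, map_pow, map_smul, map_zero] using
    RingQuot.mkAlgHom_rel ℂ (Rel.serre_F (ε := ε) i j h)

section LiftU

variable (ε : ℂ) {A : Type*} [Ring A] [Algebra ℂ A] (e f : Fin 2 → A) (k : Weight → A)
    (k_zero : k 0 = 1) (k_add : ∀ μ ν, k μ * k ν = k (μ + ν))
    (k_e : ∀ μ i, k μ * e i = ε ^ μ i • (e i * k μ))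
    (k_f : ∀ μ i, k μ * f i = ε ^ (-μ i) • (f i * k μ))
    (e_f : ∀ i, e i * f i - f i * e i = (ε - ε⁻¹)⁻¹ • (k (simpleRoot i) - k (-simpleRoot i)))
    (e_f' : ∀ i j, i ≠ j → e i * f j - f j * e i = 0)
    (se : ∀ i j, i ≠ j →
      e i ^ 2 * e j - (ε + ε⁻¹) • (e i * e j * e i) + e j * e i ^ 2 = 0)
    (sf : ∀ i j, i ≠ j →
      f i ^ 2 * f j - (ε + ε⁻¹) • (f i * f j * f i) + f j * f i ^ 2 = 0)

theorem liftU_E (i : Fin 2) :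
    liftU ε e f k k_zero k_add k_e k_f e_f e_f' se sf (E ε i) = e i := by
  rw [liftU, E, RingQuot.liftAlgHom_mkAlgHom_apply, FreeAlgebra.lift_ι_apply]

theorem liftU_F (i : Fin 2) :
    liftU ε e f k k_zero k_add k_e k_f e_f e_f' se sf (F ε i) = f i := by
  rw [liftU, F, RingQuot.liftAlgHom_mkAlgHom_apply, FreeAlgebra.lift_ι_apply]

theorem liftU_K (μ : Weight) :
    liftU ε e f k k_zero k_add k_e k_f e_f e_f' se sf (K ε μ) = k μ := by
  rw [liftU, K, RingQuot.liftAlgHom_mkAlgHom_apply, FreeAlgebra.lift_ι_apply]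

end LiftU

/-- The Serre expression is homogeneous of degree 3, so the twist's scalars factor out. -/
theorem serre_smul {A : Type*} [Ring A] [Algebra ℂ A] (c q : ℂ) (x y : A) :
    (c • x) ^ 2 * (c • y) - q • (c • x * c • y * c • x) + c • y * (c • x) ^ 2 =
      c ^ 3 • (x ^ 2 * y - q • (x * y * x) + y * x ^ 2) := by
  simp only [sq, smul_mul_assoc, mul_smul_comm]
  module

/-- Representations can be twisted by the Chevalley involution `E_i ↦ -ε⁻¹ F_i`, `F_i ↦ -ε E_i`,
`K_μ ↦ K_{-μ}`. -/
theorem exists_chevalley_twist {ε : ℂ} (h0 : ε ≠ 0) {A : Type*} [Ring A] [Algebra ℂ A]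
    (ρ : U ε →ₐ[ℂ] A) : ∃ ρ' : U ε →ₐ[ℂ] A,
      (∀ i, ρ' (E ε i) = (-ε⁻¹) • ρ (F ε i)) ∧ (∀ i, ρ' (F ε i) = (-ε) • ρ (E ε i)) ∧
        ∀ μ, ρ' (K ε μ) = ρ (K ε (-μ)) := by
  refine ⟨liftU ε (fun i => (-ε⁻¹) • ρ (F ε i)) (fun i => (-ε) • ρ (E ε i))
    (fun μ => ρ (K ε (-μ))) ?_ ?_ ?_ ?_ ?_ ?_ ?_ ?_,
    fun i => liftU_E .., fun i => liftU_F .., fun i => liftU_K ..⟩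
  · rw [neg_zero, K_zero, map_one]
  · intro μ ν
    rw [← map_mul, K_mul, neg_add]
  · intro μ i
    have h := congrArg ρ (K_mul_F ε (-μ) i)
    simp only [map_mul, map_smul, Pi.neg_apply, neg_neg] at h
    rw [mul_smul_comm, h, smul_mul_assoc, smul_comm]
  · intro μ i
    have h := congrArg ρ (K_mul_E ε (-μ) i)
    simp only [map_mul, map_smul, Pi.neg_apply] at h
    rw [mul_smul_comm, h, smul_mul_assoc, smul_comm]
  · intro i
    have h := congrArg ρ (E_mul_F_sub ε i)
    simp only [map_mul, map_smul, map_sub] at h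
    simp only [smul_mul_smul_comm]
    rw [neg_mul_neg, neg_mul_neg, inv_mul_cancel₀ h0, mul_inv_cancel₀ h0, one_smul, one_smul,
      neg_neg, ← neg_sub, h, ← smul_neg, neg_sub]
  · intro i j hij
    have h := congrArg ρ (E_mul_F_comm ε hij.symm)
    simp only [map_mul, map_zero, map_sub] at h
    simp only [smul_mul_smul_comm]
    rw [mul_comm (-ε), ← smul_sub, ← neg_sub, h, neg_zero, smul_zero]
  · intro i j hij
    have h := congrArg ρ (serre_F ε hij)
    simp only [map_mul, map_smul, map_sub, map_add, map_pow, map_zero] at h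
    rw [serre_smul, h, smul_zero]
  · intro i j hij
    have h := congrArg ρ (serre_E ε hij)
    simp only [map_mul, map_smul, map_sub, map_add, map_pow, map_zero] at h
    rw [serre_smul, h, smul_zero]

/-- The weights of the standard module, in units of `z` with `z ^ 3 = ε ^ 2`. -/
def stdWeight (μ : Weight) : Fin 3 → ℤ := ![μ 0 + 2 * μ 1, -2 * μ 0 - μ 1, μ 0 - μ 1]

/-- The action of `E_i` on the standard module. -/
def stdE (i : Fin 2) : Matrix (Fin 3) (Fin 3) ℂ :=
  if i = 0 then !![0, 0, 0; 0, 0, 1; 0, 0, 0] else !![0, 0, 0; 0, 0, 0; 1, 0, 0]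

/-- The action of `F_i` on the standard module. -/
def stdF (i : Fin 2) : Matrix (Fin 3) (Fin 3) ℂ :=
  if i = 0 then !![0, 0, 0; 0, 0, 0; 0, 1, 0] else !![0, 0, 1; 0, 0, 0; 0, 0, 0]

/-- The action of `K_μ` on the standard module. -/
def stdK (z : ℂ) (μ : Weight) : Matrix (Fin 3) (Fin 3) ℂ :=
  Matrix.diagonal fun i => z ^ stdWeight μ i

theorem stdK_zero (z : ℂ) : stdK z 0 = 1 := by
  rw [stdK, ← Matrix.diagonal_one]
  congr 1
  ext i
  fin_cases i <;> simp [stdWeight]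

theorem stdK_mul {z : ℂ} (hz : z ≠ 0) (μ ν : Weight) :
    stdK z μ * stdK z ν = stdK z (μ + ν) := by
  rw [stdK, stdK, stdK, Matrix.diagonal_mul_diagonal]
  congr 1
  ext i
  rw [← zpow_add₀ hz]
  congr 1
  fin_cases i <;> simp [stdWeight] <;> ring

theorem inv_eq_sq_of_pow_three {ε : ℂ} (hε : ε ^ 3 = 1) : ε⁻¹ = ε ^ 2 := by
  exact inv_eq_of_mul_eq_one_right (by linear_combination hε)

/-- Writing `ε` as a power of `z` turns weight identities into integer arithmetic on exponents. -/
theorem zpow_neg_three {ε z : ℂ} (hε : ε ^ 3 = 1) (hz : z ^ 3 = ε ^ 2) :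
    z ^ (-3 : ℤ) = ε := by
  rw [zpow_neg]
  norm_cast
  rw [hz, ← inv_eq_sq_of_pow_three hε, inv_inv]

theorem ne_zero_of_pow_three {ε z : ℂ} (hε : ε ^ 3 = 1) (hz : z ^ 3 = ε ^ 2) :
    z ≠ 0 := by
  rintro rfl
  have : ε ^ 6 = 0 := by linear_combination -(ε ^ 4) * hz
  have : (1 : ℂ) = 0 := by linear_combination this - (ε ^ 3 + 1) * hε
  simp at this

theorem zpow_stdWeight_one {ε z : ℂ} (hε : ε ^ 3 = 1) (hz : z ^ 3 = ε ^ 2)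
    (μ : Weight) :
    z ^ stdWeight μ 1 = ε ^ μ 0 * z ^ stdWeight μ 2 := by
  have hz0 := ne_zero_of_pow_three hε hz
  rw [← zpow_neg_three hε hz, ← zpow_mul, ← zpow_add₀ hz0]
  congr 1
  simp [stdWeight]
  ring

theorem zpow_stdWeight_two {ε z : ℂ} (hε : ε ^ 3 = 1) (hz : z ^ 3 = ε ^ 2)
    (μ : Weight) :
    z ^ stdWeight μ 2 = ε ^ μ 1 * z ^ stdWeight μ 0 := by
  have hz0 := ne_zero_of_pow_three hε hz
  rw [← zpow_neg_three hε hz, ← zpow_mul, ← zpow_add₀ hz0]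
  congr 1
  simp [stdWeight]
  ring

theorem stdK_simpleRoot_zero {ε z : ℂ} (hε : ε ^ 3 = 1) (hz : z ^ 3 = ε ^ 2) :
    stdK z (simpleRoot 0) = Matrix.diagonal ![1, ε, ε ^ 2] ∧
      stdK z (-simpleRoot 0) = Matrix.diagonal ![1, ε ^ 2, ε] := by
  have h1 : stdWeight (simpleRoot 0) = ![0, -3, 3] := by ext i; fin_cases i <;> rfl
  have h2 : stdWeight (-simpleRoot 0) = ![0, 3, -3] := by ext i; fin_cases i <;> rfl
  have h3 : z ^ (3 : ℤ) = ε ^ 2 := by exact_mod_cast hz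
  have h4 := zpow_neg_three hε hz
  constructor <;> simp only [stdK, h1, h2] <;> congr 1 <;> ext i <;>
    fin_cases i <;> first | exact h3 | exact h4 | exact zpow_zero z

theorem stdK_simpleRoot_one {ε z : ℂ} (hε : ε ^ 3 = 1) (hz : z ^ 3 = ε ^ 2) :
    stdK z (simpleRoot 1) = Matrix.diagonal ![ε ^ 2, 1, ε] ∧
      stdK z (-simpleRoot 1) = Matrix.diagonal ![ε, 1, ε ^ 2] := by
  have h1 : stdWeight (simpleRoot 1) = ![3, 0, -3] := by ext i; fin_cases i <;> rfl
  have h2 : stdWeight (-simpleRoot 1) = ![-3, 0, 3] := by ext i; fin_cases i <;> rfl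
  have h3 : z ^ (3 : ℤ) = ε ^ 2 := by exact_mod_cast hz
  have h4 := zpow_neg_three hε hz
  constructor <;> simp only [stdK, h1, h2] <;> congr 1 <;> ext i <;>
    fin_cases i <;> first | exact h3 | exact h4 | exact zpow_zero z

theorem stdK_mul_stdE {ε z : ℂ} (hε : ε ^ 3 = 1) (hz : z ^ 3 = ε ^ 2)
    (μ : Weight) (i : Fin 2) :
    stdK z μ * stdE i = ε ^ μ i • (stdE i * stdK z μ) := by
  have h1 := zpow_stdWeight_one hε hz μ
  have h2 := zpow_stdWeight_two hε hz μ
  ext p q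
  rw [Matrix.smul_apply, stdK, Matrix.diagonal_mul, Matrix.mul_diagonal]
  fin_cases i <;> fin_cases p <;> fin_cases q <;>
    simp [stdE, h1, h2]

theorem stdK_mul_stdF {ε z : ℂ} (hε : ε ^ 3 = 1) (hz : z ^ 3 = ε ^ 2)
    (μ : Weight) (i : Fin 2) :
    stdK z μ * stdF i = ε ^ (-μ i) • (stdF i * stdK z μ) := by
  have h0 : ε ≠ 0 := by rintro rfl; simp at hε
  have h1 := zpow_stdWeight_one hε hz μ
  have h2 := zpow_stdWeight_two hε hz μ
  ext p q
  rw [Matrix.smul_apply, stdK, Matrix.diagonal_mul, Matrix.mul_diagonal]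
  fin_cases i <;> fin_cases p <;> fin_cases q <;>
    simp [stdF, h1, h2, inv_mul_cancel_left₀ (zpow_ne_zero _ h0)]

theorem stdE_mul_stdF_sub {ε z : ℂ} (hε : ε ^ 3 = 1) (hz : z ^ 3 = ε ^ 2)
    (h1 : ε ≠ 1) (i : Fin 2) :
    stdE i * stdF i - stdF i * stdE i =
      (ε - ε⁻¹)⁻¹ • (stdK z (simpleRoot i) - stdK z (-simpleRoot i)) := by
  have h0 : ε ≠ 0 := by rintro rfl; simp at hε
  have hd : ε - ε ^ 2 ≠ 0 := fun h => h1 (by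
    have : ε * (1 - ε) = 0 := by linear_combination h
    rcases mul_eq_zero.1 this with h | h
    · exact absurd h h0
    · linear_combination -h)
  obtain ⟨a1, a2⟩ := stdK_simpleRoot_zero hε hz
  obtain ⟨b1, b2⟩ := stdK_simpleRoot_one hε hz
  rw [inv_eq_sq_of_pow_three hε, eq_inv_smul_iff₀ hd]
  fin_cases i
  · change _ • (stdE 0 * stdF 0 - stdF 0 * stdE 0) =
      stdK z (simpleRoot 0) - stdK z (-simpleRoot 0)
    rw [a1, a2]
    ext p q
    fin_cases p <;> fin_cases q <;> simp [stdE, stdF]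
  · change _ • (stdE 1 * stdF 1 - stdF 1 * stdE 1) =
      stdK z (simpleRoot 1) - stdK z (-simpleRoot 1)
    rw [b1, b2]
    ext p q
    fin_cases p <;> fin_cases q <;> simp [stdE, stdF]

/-- The three-dimensional representation of `U ε` for `ε` of order three. -/
theorem exists_stdRep {ε z : ℂ} (hε : ε ^ 3 = 1) (hz : z ^ 3 = ε ^ 2)
    (h1 : ε ≠ 1) : ∃ ρ : U ε →ₐ[ℂ] Matrix (Fin 3) (Fin 3) ℂ,
    (∀ i, ρ (E ε i) = stdE i) ∧ (∀ i, ρ (F ε i) = stdF i) ∧ ∀ μ, ρ (K ε μ) = stdK z μ := by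
  refine ⟨liftU ε stdE stdF (stdK z) (stdK_zero z) (stdK_mul (ne_zero_of_pow_three hε hz))
    (stdK_mul_stdE hε hz) (stdK_mul_stdF hε hz) (stdE_mul_stdF_sub hε hz h1)
    ?_ ?_ ?_, fun i => liftU_E .., fun i => liftU_F .., fun i => liftU_K ..⟩
  -- For these matrix units every monomial in the three relations vanishes.
  all_goals
    intro i j hij
    ext p q
    fin_cases i <;> fin_cases j <;> (try exact absurd rfl hij) <;>
      fin_cases p <;> fin_cases q <;>
        simp [stdE, stdF, sq]

/-- The diagonal entries of `stdK z μ` differ by powers of `ε`, which cubing removes. -/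
theorem stdK_pow_three {ε z : ℂ} (hε : ε ^ 3 = 1) (hz : z ^ 3 = ε ^ 2)
    (μ : Weight) :
    stdK z μ ^ 3 = algebraMap ℂ _ ((ε ^ 2) ^ (μ 0 + 2 * μ 1)) := by
  have h1 := zpow_stdWeight_one hε hz μ
  have h2 := zpow_stdWeight_two hε hz μ
  have h3 : ∀ n : ℤ, (ε ^ n) ^ 3 = 1 := fun n => by
    rw [← zpow_natCast, zpow_comm, zpow_natCast, hε, one_zpow]
  have h4 : (z ^ stdWeight μ 0) ^ 3 = (ε ^ 2) ^ (μ 0 + 2 * μ 1) := by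
    rw [← hz, ← zpow_natCast, zpow_comm, zpow_natCast]
    rfl
  rw [stdK, Matrix.diagonal_pow, Matrix.algebraMap_eq_diagonal]
  congr 1
  ext i
  fin_cases i <;> simp [h1, h2, mul_pow, h3, h4]

/-- The four matrix units join index 2 to indices 0 and 1 in both directions, so their products give
all nine. -/
theorem surjective_of_stdE_stdF_mem {A : Type*} [Ring A] [Algebra ℂ A]
    (ρ : A →ₐ[ℂ] Matrix (Fin 3) (Fin 3) ℂ) (hE : ∀ i, stdE i ∈ ρ.range)
    (hF : ∀ i, stdF i ∈ ρ.range) : Function.Surjective ρ := by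
  have h12 : Matrix.single 1 2 1 ∈ ρ.range := by
    convert hE 0; ext p q; fin_cases p <;> fin_cases q <;> simp [stdE]
  have h20 : Matrix.single 2 0 1 ∈ ρ.range := by
    convert hE 1; ext p q; fin_cases p <;> fin_cases q <;> simp [stdE]
  have h21 : Matrix.single 2 1 1 ∈ ρ.range := by
    convert hF 0; ext p q; fin_cases p <;> fin_cases q <;> simp [stdF]
  have h02 : Matrix.single 0 2 1 ∈ ρ.range := by
    convert hF 1; ext p q; fin_cases p <;> fin_cases q <;> simp [stdF]
  have hmul : ∀ {i j k : Fin 3}, Matrix.single i j 1 ∈ ρ.range → Matrix.single j k 1 ∈ ρ.range →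
      Matrix.single i k (1 : ℂ) ∈ ρ.range := fun {i j k} hi hj => by
    simpa using mul_mem hi hj
  have hall : ∀ i j : Fin 3, Matrix.single i j (1 : ℂ) ∈ ρ.range := by
    intro i j
    fin_cases i <;> fin_cases j
    exacts [hmul h02 h20, hmul h02 h21, h02, hmul h12 h20, hmul h12 h21, h12, h20, h21,
      hmul h21 h12]
  intro M
  change M ∈ ρ.range
  rw [Matrix.matrix_eq_sum_single M]
  refine sum_mem fun i _ => sum_mem fun j _ => ?_
  have := ρ.range.smul_mem (hall i j) (M i j)
  simpa [Matrix.smul_single] using this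

theorem toLin_dualBasis_apply (M : Matrix (Fin 3) (Fin 3) ℂ) (f : Module.Dual ℂ (Fin 3 → ℂ))
    (v : Fin 3 → ℂ) :
    Matrix.toLinAlgEquiv (Pi.basisFun ℂ (Fin 3)).dualBasis M f v = f (M.transpose.mulVec v) := by
  have h : (Matrix.toLinAlgEquiv (Pi.basisFun ℂ (Fin 3)).dualBasis M) =
      Module.Dual.transpose (R := ℂ) M.transpose.mulVecLin := by
    refine (Pi.basisFun ℂ (Fin 3)).dualBasis.ext fun i => LinearMap.ext fun w => ?_
    rw [Matrix.toLinAlgEquiv_self]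
    simp [Matrix.vecMul, dotProduct, mul_comm, Module.Dual.transpose]
  rw [h]
  rfl

end Standard

/-! ### Nilpotence of the root vectors -/

section Nilpotence

variable {ε : ℂ} (ρ : U ε →ₐ[ℂ] Matrix (Fin 3) (Fin 3) ℂ)

theorem stdE_pow_three (i : Fin 2) : stdE i ^ 3 = 0 := by
  ext p q
  fin_cases i <;> fin_cases p <;> fin_cases q <;> simp [stdE, pow_succ]

theorem stdF_pow_three (i : Fin 2) : stdF i ^ 3 = 0 := by
  ext p q
  fin_cases i <;> fin_cases p <;> fin_cases q <;> simp [stdF, pow_succ]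

theorem stdE_bracket_pow_three (a b : ℂ) :
    (a • (stdE 1 * stdE 0) + b • (stdE 0 * stdE 1)) ^ 3 = 0 := by
  ext p q
  fin_cases p <;> fin_cases q <;> simp [stdE, pow_succ, Matrix.mul_apply]

theorem stdF_bracket_pow_three (a b : ℂ) :
    (a • (stdF 1 * stdF 0) + b • (stdF 0 * stdF 1)) ^ 3 = 0 := by
  ext p q
  fin_cases p <;> fin_cases q <;> simp [stdF, pow_succ, Matrix.mul_apply]

variable {X : Fin 2 → Matrix (Fin 3) (Fin 3) ℂ} {c : ℂ}

/-- Taking `X` and `c` general covers both the representation (`stdE`, `c = 1`) and its twist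
(`stdF`, `c = -ε⁻¹`). -/
theorem map_rootE_pow_three (hX : ∀ i, X i ^ 3 = 0)
    (hX' : ∀ a b : ℂ, (a • (X 1 * X 0) + b • (X 0 * X 1)) ^ 3 = 0)
    (h : ∀ i, ρ (E ε i) = c • X i) (γ : PosRoot) : ρ (rootE ε γ) ^ 3 = 0 := by
  rcases γ with _ | _ | _
  · rw [rootE, h, smul_pow, hX, smul_zero]
  · rw [← hX' (-(c * c)) (ε⁻¹ * (c * c)), rootE]
    simp only [map_add, map_neg, map_smul, map_mul, h, smul_mul_smul_comm, smul_smul, neg_smul]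
  · rw [rootE, h, smul_pow, hX, smul_zero]

theorem map_rootF_pow_three (hX : ∀ i, X i ^ 3 = 0)
    (hX' : ∀ a b : ℂ, (a • (X 1 * X 0) + b • (X 0 * X 1)) ^ 3 = 0)
    (h : ∀ i, ρ (F ε i) = c • X i) (γ : PosRoot) : ρ (rootF ε γ) ^ 3 = 0 := by
  rcases γ with _ | _ | _
  · rw [rootF, h, smul_pow, hX, smul_zero]
  · rw [← hX' (ε * (c * c)) (-(c * c)), rootF, add_comm]
    simp only [map_add, map_neg, map_smul, map_mul, h, smul_mul_smul_comm, smul_smul, neg_smul]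
  · rw [rootF, h, smul_pow, hX, smul_zero]

end Nilpotence

/-- A `U_η`-module pulled back to `U_ε` has character `η`, as `z - η(z)` lies in `ker η`; the lower
bound then applies. -/
theorem finrank_ne_one {ε : ℂ} {ℓ : ℕ} (hodd : Odd ℓ) (h3 : 3 ∣ ℓ) (hε : IsPrimitiveRoot ε ℓ)
    (η : EllChar ε ℓ) (hc : IsCentralChar η) (h1 : piMap η ≠ 1) (V : Type*) [AddCommGroup V]
    [Module ℂ V] [Module (Ured η) V] [IsScalarTower ℂ (Ured η) V] :
    Module.finrank ℂ V ≠ 1 := fun hV => by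
  let m : Module (U ε) V := Module.compHom V (toUred η).toRingHom
  have hm : ∀ (x : U ε) (v : V), x • v = toUred η x • v := fun _ _ => rfl
  have : IsScalarTower ℂ (U ε) V := ⟨fun c x v => by rw [hm, hm, map_smul, smul_assoc]⟩
  have : FiniteDimensional ℂ V := Module.finite_of_finrank_eq_succ hV
  have : Nontrivial V := Module.nontrivial_of_finrank_pos (R := ℂ) (by omega)
  have h := two_lt_finrank (V := V) hodd h3 hε η hc h1 fun z v => by
    have hz0 : η (z - algebraMap ℂ (ellCenter ε ℓ) (η z)) = 0 := by
      refine (map_sub η z (algebraMap ℂ _ (η z))).trans ?_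
      rw [AlgHom.commutes, Algebra.algebraMap_self_apply, sub_self]
    have hz : toUred η ((z - algebraMap ℂ (ellCenter ε ℓ) (η z) : ellCenter ε ℓ) : U ε) = 0 := by
      have := RingQuot.mkAlgHom_rel ℂ (s := fun a b : U ε =>
        ∃ z : ellCenter ε ℓ, η z = 0 ∧ a = (z : U ε) ∧ b = 0)
        ⟨z - algebraMap ℂ (ellCenter ε ℓ) (η z), hz0, rfl, rfl⟩
      rwa [map_zero] at this
    have hz' : toUred η z = algebraMap ℂ (Ured η) (η z) := by
      rw [← sub_eq_zero, ← hz, AddSubgroupClass.coe_sub, map_sub]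
      congr 1
      exact ((toUred η).commutes _).symm
    rw [hm, hz', algebraMap_smul]
  omega

/-! ### Matching the dual action with the twist -/

section Dual

variable {ε z : ℂ}

theorem stdF_transpose (i : Fin 2) : (stdF i).transpose = stdE i := by
  ext p q
  fin_cases i <;> fin_cases p <;> fin_cases q <;> rfl

theorem stdE_transpose (i : Fin 2) : (stdE i).transpose = stdF i := by
  rw [← stdF_transpose, Matrix.transpose_transpose]

/-- The image of `E_i` is a single weight line, on which `K_{-α_i}` is `ε⁻¹`. This is the scalar
occurring in the Chevalley twist. -/
theorem stdK_neg_mul_stdE (hε : ε ^ 3 = 1) (hz : z ^ 3 = ε ^ 2) (i : Fin 2) :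
    stdK z (-simpleRoot i) * stdE i = ε⁻¹ • stdE i := by
  rw [inv_eq_sq_of_pow_three hε]
  obtain rfl | rfl : i = 0 ∨ i = 1 := by omega
  · rw [(stdK_simpleRoot_zero hε hz).2]
    ext p q
    fin_cases p <;> fin_cases q <;> simp [stdE]
  · rw [(stdK_simpleRoot_one hε hz).2]
    ext p q
    fin_cases p <;> fin_cases q <;> simp [stdE]

theorem stdF_mul_stdK (hε : ε ^ 3 = 1) (hz : z ^ 3 = ε ^ 2) (i : Fin 2) :
    stdF i * stdK z (simpleRoot i) = ε • stdF i := by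
  obtain rfl | rfl : i = 0 ∨ i = 1 := by omega
  · rw [(stdK_simpleRoot_zero hε hz).1]
    ext p q
    rw [Matrix.mul_diagonal]
    fin_cases p <;> fin_cases q <;> simp [stdF]
  · rw [(stdK_simpleRoot_one hε hz).1]
    ext p q
    rw [Matrix.mul_diagonal]
    fin_cases p <;> fin_cases q <;> simp [stdF]

end Dual

end QuantumSL3

end

/-! ### The main theorem -/

open QuantumSL3 in
theorem mainTheorem6 :
    -- no small module when the central element has order three
    (∀ (ℓ : ℕ) (ε : ℂ), Odd ℓ → 3 ∣ ℓ → IsPrimitiveRoot ε ℓ →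
      ∀ η : QuantumSL3.EllChar ε ℓ, QuantumSL3.IsCentralChar η →
        orderOf (QuantumSL3.piMap η) = 3 →
        ∀ (V : Type*) [AddCommGroup V] [Module ℂ V] [Module (QuantumSL3.Ured η) V]
          [IsScalarTower ℂ (QuantumSL3.Ured η) V],
          ¬ QuantumSL3.IsSmallModule η V ∧ Module.finrank ℂ V ≠ 1) ∧
    -- the lower bound for irreducible modules
    (∀ (ℓ : ℕ) (ε : ℂ), Odd ℓ → 3 ∣ ℓ → IsPrimitiveRoot ε ℓ →
      ∀ η : QuantumSL3.EllChar ε ℓ, QuantumSL3.IsCentralChar η →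
        QuantumSL3.piMap η ≠ 1 →
        ∀ (V : Type*) [AddCommGroup V] [Module ℂ V] [Module (QuantumSL3.U ε) V]
          [IsScalarTower ℂ (QuantumSL3.U ε) V] [IsSimpleModule (QuantumSL3.U ε) V],
          QuantumSL3.HasEllChar η V → 3 ≤ Module.rank ℂ V) ∧
    -- the explicit three-dimensional irreducible module for `ℓ = 3`, and its dual
    (∀ ε z : ℂ, IsPrimitiveRoot ε 3 → z ^ 3 = ε ^ 2 →
      ∃ η : QuantumSL3.EllChar ε 3,
        QuantumSL3.IsCentralChar η ∧ QuantumSL3.piMap η ≠ 1 ∧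
        η (QuantumSL3.ellK ε 3 ![1, 0] ^ 2) = ε ∧
        ∃ (_ : Module (QuantumSL3.Ured η) (Fin 3 → ℂ))
          (_ : IsScalarTower ℂ (QuantumSL3.Ured η) (Fin 3 → ℂ)),
          IsSimpleModule (QuantumSL3.Ured η) (Fin 3 → ℂ) ∧
          (∀ v : Fin 3 → ℂ,
            QuantumSL3.toUred η (QuantumSL3.E ε 0) • v =
              !![0, 0, 0; 0, 0, 1; 0, 0, 0].mulVec v ∧
            QuantumSL3.toUred η (QuantumSL3.E ε 1) • v =
              !![0, 0, 0; 0, 0, 0; 1, 0, 0].mulVec v ∧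
            QuantumSL3.toUred η (QuantumSL3.F ε 0) • v =
              !![0, 0, 0; 0, 0, 0; 0, 1, 0].mulVec v ∧
            QuantumSL3.toUred η (QuantumSL3.F ε 1) • v =
              !![0, 0, 1; 0, 0, 0; 0, 0, 0].mulVec v ∧
            QuantumSL3.toUred η (QuantumSL3.K ε ![1, 0]) • v =
              (Matrix.diagonal ![z, (z ^ 2)⁻¹, z]).mulVec v ∧
            QuantumSL3.toUred η (QuantumSL3.K ε (QuantumSL3.simpleRoot 0)) • v =
              (Matrix.diagonal ![1, ε, ε ^ 2]).mulVec v) ∧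
          ∃ η' : QuantumSL3.EllChar ε 3,
            QuantumSL3.IsCentralChar η' ∧ QuantumSL3.piMap η' ≠ 1 ∧
            η' (QuantumSL3.ellK ε 3 ![1, 0] ^ 2) = ε ^ 2 ∧
            ∃ (_ : Module (QuantumSL3.Ured η') (Module.Dual ℂ (Fin 3 → ℂ)))
              (_ : IsScalarTower ℂ (QuantumSL3.Ured η') (Module.Dual ℂ (Fin 3 → ℂ))),
              IsSimpleModule (QuantumSL3.Ured η') (Module.Dual ℂ (Fin 3 → ℂ)) ∧
              ∀ (f : Module.Dual ℂ (Fin 3 → ℂ)) (v : Fin 3 → ℂ),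
                (∀ i : Fin 2,
                  (QuantumSL3.toUred η' (QuantumSL3.E ε i) • f) v =
                    -f (QuantumSL3.toUred η (QuantumSL3.K ε (-QuantumSL3.simpleRoot i)) •
                      QuantumSL3.toUred η (QuantumSL3.E ε i) • v) ∧
                  (QuantumSL3.toUred η' (QuantumSL3.F ε i) • f) v =
                    -f (QuantumSL3.toUred η (QuantumSL3.F ε i) •
                      QuantumSL3.toUred η (QuantumSL3.K ε (QuantumSL3.simpleRoot i)) • v)) ∧
                ∀ μ : QuantumSL3.Weight,
                  (QuantumSL3.toUred η' (QuantumSL3.K ε μ) • f) v =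
                    f (QuantumSL3.toUred η (QuantumSL3.K ε (-μ)) • v)) := by
  refine ⟨?_, ?_, ?_⟩
  · intro ℓ ε hodd h3 hε η hc hord V _ _ _ _
    have h1 : QuantumSL3.piMap η ≠ 1 := fun h => by simp [h] at hord
    have hV := QuantumSL3.finrank_ne_one hodd h3 hε η hc h1 V
    refine ⟨?_, hV⟩
    rintro ⟨d, hd, hd'⟩
    rw [QuantumSL3.classDim_of_mem_center hc] at hd
    have hd0 : 2 * d = 0 := by exact_mod_cast hd.symm
    obtain rfl : d = 0 := by omega
    exact hV (by rw [hd', pow_zero])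
  · intro ℓ ε hodd h3 hε η hc h1 V _ _ _ _ _ hη
    by_contra! hlt
    have : FiniteDimensional ℂ V :=
      Module.rank_lt_aleph0_iff.1 (hlt.trans (by exact_mod_cast Cardinal.natCast_lt_aleph0 (n := 3)))
    have : Nontrivial V := IsSimpleModule.nontrivial (QuantumSL3.U ε) V
    have h := QuantumSL3.two_lt_finrank (V := V) hodd h3 hε η hc h1 hη
    rw [← Module.finrank_eq_rank] at hlt
    have : Module.finrank ℂ V < 3 := by exact_mod_cast hlt
    omega
  · intro ε z hε hz
    have hε3 : ε ^ 3 = 1 := hε.pow_eq_one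
    have hε0 : ε ≠ 0 := hε.ne_zero (by norm_num)
    have hε1 : ε ≠ 1 := hε.ne_one (by norm_num)
    have hinv := inv_eq_sq_of_pow_three hε3
    obtain ⟨ρ, hE, hF, hK⟩ := exists_stdRep hε3 hz hε1
    obtain ⟨ρ', hE', hF', hK'⟩ := exists_chevalley_twist hε0 ρ
    have hsurj : Function.Surjective ρ := surjective_of_stdE_stdF_mem ρ
      (fun i => ⟨E ε i, hE i⟩) (fun i => ⟨F ε i, hF i⟩)
    have hsurj' : Function.Surjective ρ' := surjective_of_stdE_stdF_mem ρ'
      (fun i => (AlgHom.mem_range ρ').2 ⟨(-ε⁻¹) • F ε i, by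
        rw [map_smul, hF', hE, smul_smul, neg_mul_neg, inv_mul_cancel₀ hε0, one_smul]⟩)
      (fun i => (AlgHom.mem_range ρ').2 ⟨(-ε) • E ε i, by
        rw [map_smul, hE', hF, smul_smul, neg_mul_neg, mul_inv_cancel₀ hε0, one_smul]⟩)
    -- `K_{λ₁}³` acts as `z³ = ε²`, hence `a = ε²` and `K_{λ₁}⁶` acts as `ε⁴ = ε`.
    obtain ⟨η, hc, h1, hη6, hη⟩ := exists_central_ellChar (ℓ := 3) (a := ε ^ 2) ρ
      (map_rootE_pow_three ρ (c := 1) stdE_pow_three stdE_bracket_pow_three (by simpa using hE))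
      (map_rootF_pow_three ρ (c := 1) stdF_pow_three stdF_bracket_pow_three (by simpa using hF))
      (by linear_combination (ε ^ 3 + 1) * hε3)
      (fun h => hε1 (by linear_combination hε3 - ε * h))
      (fun μ => by rw [hK, stdK_pow_three hε3 hz])
    -- The twist inverts `K_μ`, so here `a = (ε²)⁻¹ = ε`.
    obtain ⟨η', hc', h1', hη6', hη'⟩ := exists_central_ellChar (ℓ := 3) (a := ε) ρ'
      (map_rootE_pow_three ρ' stdF_pow_three stdF_bracket_pow_three (fun i => by rw [hE', hF]))
      (map_rootF_pow_three ρ' stdE_pow_three stdE_bracket_pow_three (fun i => by rw [hF', hE]))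
      hε3 hε1
      (fun μ => by
        rw [hK', hK, stdK_pow_three hε3 hz, ← hinv, inv_zpow', Pi.neg_apply, Pi.neg_apply]
        congr 2
        ring)
    obtain ⟨m, hm, hs, hact⟩ := exists_simple_module
      ((Matrix.toLinAlgEquiv' : _ ≃ₐ[ℂ] _).toAlgHom.comp ρ)
      (Matrix.toLinAlgEquiv'.surjective.comp hsurj) η
      (fun z => by
        change Matrix.toLinAlgEquiv' (ρ z) = _
        rw [hη, AlgEquiv.commutes])
    -- In the dual basis a matrix acts on functionals through its transpose, which swaps `stdE` and
    -- `stdF` back.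
    let φ := Matrix.toLinAlgEquiv (Pi.basisFun ℂ (Fin 3)).dualBasis
    obtain ⟨m', hm', hs', hact'⟩ := exists_simple_module (φ.toAlgHom.comp ρ')
      (φ.surjective.comp hsurj') η'
      (fun z => by
        change φ (ρ' z) = _
        rw [hη', AlgEquiv.commutes])
    have hv : ∀ (x : U ε) (v : Fin 3 → ℂ), toUred η x • v = (ρ x).mulVec v := hact
    have hv' : ∀ (x : U ε) (f : Module.Dual ℂ (Fin 3 → ℂ)) (v : Fin 3 → ℂ),
        (toUred η' x • f) v = f ((ρ' x).transpose.mulVec v) := fun x f v => by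
      rw [hact', ← toLin_dualBasis_apply]
      rfl
    refine ⟨η, hc, h1, by rw [hη6]; linear_combination ε * hε3, m, hm, hs, fun v => ?_,
      η', hc', h1', hη6', m', hm', hs', fun f v => ⟨fun i => ⟨?_, ?_⟩, fun μ => ?_⟩⟩
    · simp only [hv, hE, hF, hK, (stdK_simpleRoot_zero hε3 hz).1]
      refine ⟨rfl, rfl, rfl, rfl, ?_, trivial⟩
      rw [stdK]
      congr 2
      ext i
      fin_cases i <;> simp [stdWeight]
    · rw [hv', hv, hv, hE', hE, hK, hF, Matrix.mulVec_mulVec, stdK_neg_mul_stdE hε3 hz,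
        Matrix.transpose_smul, stdF_transpose, neg_smul, Matrix.neg_mulVec, map_neg]
    · rw [hv', hv, hv, hF', hE, hK, hF, Matrix.mulVec_mulVec, stdF_mul_stdK hε3 hz,
        Matrix.transpose_smul, stdE_transpose, neg_smul, Matrix.neg_mulVec, map_neg]
    · rw [hv', hv, hK', hK, stdK, Matrix.diagonal_transpose]
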